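/- **Crystals.** Let $I=\{0,1,2\}$ and let $P_{cl}=\bigoplus_{i\in I}\mathbb{Z}\Lambda_i$ with $\langle h_i,\Lambda_k\rangle=\delta_{ik}$. A $U_q'(G_2^{(1)})$-crystal is a set $\mathcal B$ with maps $\mathrm{wt}:\mathcal B\to P_{cl}$, $\tilde e_i,\tilde f_i:\mathcal B\to\mathcal B\cup\{0\}$ and $\varepsilon_i,\varphi_i$ on $\mathcal B$ satisfying the usual axioms, in particular $\mathrm{wt}(b)=\sum_i(\varphi_i(b)-\varepsilon_i(b))\Lambda_i$. The tensor product $\mathcal B\otimes\mathcal B'$ is $\mathcal B\times\mathcal B'$ with $\mathrm{wt}(b\otimes b')=\mathrm{wt}(b)+\mathrm{wt}(b')$, $\varepsilon_i(b\otimes b')=\max(\varepsilon_i(b),\varepsilon_i(b')-\langle h_i,\mathrm{wt}(b)\rangle)$, $\varphi_i(b\otimes b')=\max(\varphi_i(b'),\varphi_i(b)+\langle h_i,\mathrm{wt}(b')\rangle)$; $\tilde e_i(b\otimes b')$ is $\tilde e_ib\otimes b'$ if $\varphi_i(b)\ge\varepsilon_i(b')$ and $b\otimes\tilde e_ib'$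 otherwise; $\tilde f_i(b\otimes b')$ is $\tilde f_ib\otimes b'$ if $\varphi_i(b)>\varepsilon_i(b')$ and $b\otimes\tilde f_ib'$ otherwise; here $b\otimes 0=0\otimes b'=0$. A crystal isomorphism is a bijection $\Psi:\mathcal B\cup\{0\}\to\mathcal B'\cup\{0\}$ with $\Psi(0)=0$ which preserves $\mathrm{wt},\varepsilon_i,\varphi_i$ and for which $\tilde f_ib=b'$ implies $\tilde f_i\Psi(b)=\Psi(b')$ and $\Psi(b)=\tilde e_i\Psi(b')$. **The crystal $\mathcal B_l$.** For an integer $l\ge1$ let $\mathcal B_l$ be the set of all $b=(x_1,x_2,x_3,\bar x_3,\bar x_2,\bar x_1)\in(\tfrac13\mathbb Z_{\ge0})^6$ with $3x_3\equiv3\bar x_3\pmod 2$, with $x_1,\bar x_1,x_2-x_3,\bar x_3-\bar x_2\in\mathbb Z$, and with $s(b):=x_1+x_2+\frac{x_3+\bar x_3}2+\bar x_2+\bar x_1\le l$. Put $z_1=\bar x_1-x_1$, $z_2=\bar x_2-\bar x_3$, $z_3=x_3-x_2$, $z_4=\frac{\bar x_3-x_3}2$, $(a)_+=\max(a,0)$,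 and $A=\{0,\,z_1,\,z_1+z_2,\,z_1+z_2+3z_4,\,z_1+z_2+z_3+3z_4,\,2z_1+z_2+z_3+3z_4\}$. Consider the conditions - $(F_1)$ $z_1+z_2+z_3+3z_4\le0,\ z_1+z_2+3z_4\le0,\ z_1+z_2\le0,\ z_1\le0$; - $(F_2)$ $z_1+z_2+z_3+3z_4\le0,\ z_2+3z_4\le0,\ z_2\le0,\ z_1>0$; - $(F_3)$ $z_1+z_3+3z_4\le0,\ z_3+3z_4\le0,\ z_4\le0,\ z_2>0,\ z_1+z_2>0$; - $(F_4)$ $z_1+z_2+3z_4>0,\ z_2+3z_4>0,\ z_4>0,\ z_3\le0,\ z_1+z_3\le0$; - $(F_5)$ $z_1+z_2+z_3+3z_4>0,\ z_3+3z_4>0,\ z_3>0,\ z_1\le0$; - $(F_6)$ $z_1+z_2+z_3+3z_4>0,\ z_1+z_3+3z_4>0,\ z_1+z_3>0,\ z_1>0$; and let $(E_k)$ be $(F_k)$ with $>$ replaced by $\ge$ and $\le$ replaced by $<$. Below, each operator adds the indicated vector to $(x_1,x_2,x_3,\bar x_3,\bar x_2,\bar x_1)$, and the result is understood to be $0$ if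 it is not in $\mathcal B_l$. - $\tilde e_0$: $(-1,0,0,0,0,0)$ if $(E_1)$; $(0,0,-1,-1,0,1)$ if $(E_2)$; if $(E_3)$: $(0,-\frac23,-\frac23,\frac43,\frac13,0)$ when $z_4=-\frac13$, $(0,-\frac13,-\frac43,\frac23,\frac23,0)$ when $z_4=-\frac23$, and $(0,0,-2,0,1,0)$ otherwise; $(0,-1,0,2,0,0)$ if $(E_4)$; $(-1,0,1,1,0,0)$ if $(E_5)$; $(0,0,0,0,0,1)$ if $(E_6)$. - $\tilde f_0$: $(1,0,0,0,0,0)$ if $(F_1)$; $(0,0,1,1,0,-1)$ if $(F_2)$; $(0,0,2,0,-1,0)$ if $(F_3)$; if $(F_4)$: $(0,\frac13,\frac43,-\frac23,-\frac23,0)$ when $z_4=\frac13$, $(0,\frac23,\frac23,-\frac43,-\frac13,0)$ when $z_4=\frac23$, and $(0,1,0,-2,0,0)$ otherwise; $(1,0,-1,-1,0,0)$ if $(F_5)$; $(0,0,0,0,0,-1)$ if $(F_6)$. - $\tilde e_1$: $(0,0,0,0,1,-1)$ if $z_2\ge(-z_3)_+$; $(0,0,1,-1,0,0)$ if $z_2<0\le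 z_3$; $(1,-1,0,0,0,0)$ if $(z_2)_+<-z_3$. - $\tilde f_1$: $(-1,1,0,0,0,0)$ if $(z_2)_+\le-z_3$; $(0,0,-1,1,0,0)$ if $z_2\le0<z_3$; $(0,0,0,0,-1,1)$ if $z_2>(-z_3)_+$. - $\tilde e_2$: $(0,0,0,\frac23,-\frac13,0)$ if $z_4\ge0$; $(0,\frac13,-\frac23,0,0,0)$ if $z_4<0$. - $\tilde f_2$: $(0,-\frac13,\frac23,0,0,0)$ if $z_4\le0$; $(0,0,0,-\frac23,\frac13,0)$ if $z_4>0$. Finally $\varphi_0=l-s(b)+\max A$, $\varepsilon_0=\varphi_0-(2z_1+z_2+z_3+3z_4)$, $\varepsilon_1=\bar x_1+(\bar x_3-\bar x_2+(x_2-x_3)_+)_+$, $\varphi_1=x_1+(x_3-x_2+(\bar x_2-\bar x_3)_+)_+$, $\varepsilon_2=3\bar x_2+\frac32(x_3-\bar x_3)_+$, $\varphi_2=3x_2+\frac32(\bar x_3-x_3)_+$. **Proposition.** Let $l\ge1$ and let $\mathcal R:\mathcal B_l\otimes\mathcal B_1\to\mathcal B_1\otimes\mathcal B_l$ be the $U_q'(G_2^{(1)})$-crystal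 isomorphism. Write $\mathbf 1=(1,0,0,0,0,0)$, $\mathbf 0=(0,0,0,0,0,0)$. For $b_1=(j,0,0,0,0,0)\in\mathcal B_l$ and $b_2\in\mathcal B_1$ as listed, $\mathcal R(b_1\otimes b_2)$ equals 1. $\mathbf 1\otimes(l,0,0,0,0,0)$ if $b_2=\mathbf 1$ and $j=l$; 2. $\mathbf 0\otimes(l,0,0,0,0,0)$ if $b_2=\mathbf 1$ and $j=l-1$; 3. $\mathbf 1\otimes(j+1,0,0,0,0,1)$ if $b_2=\mathbf 1$ and $0\le j\le l-2$; 4. $\mathbf 1\otimes(l-1,0,0,0,0,0)$ if $b_2=\mathbf 0$ and $j=l$; 5. $\mathbf 0\otimes(j,0,0,0,0,0)$ if $b_2=\mathbf 0$ and $0\le j\le l-1$; 6. $\mathbf 1\otimes(l-1,1,0,0,0,0)$ if $b_2=(0,1,0,0,0,0)$ and $j=l$; 7. $\mathbf 1\otimes(j-1,1,1,1,0,0)$ if $b_2=(0,1,0,0,0,0)$ and $1\le j\le l-1$; 8. $\mathbf 1\otimes(j-1,\frac13,\frac13,1,0,0)$ if $b_2=(0,\frac13,\frac13,1,0,0)$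 and $1\le j\le l$; 9. $\mathbf 1\otimes(j-1,0,1,1,0,0)$ if $b_2=(0,0,1,1,0,0)$ and $1\le j\le l$; 10. $\mathbf 1\otimes(j-2,1,0,0,0,0)$ if $b_2=(0,0,0,2,0,0)$ and $2\le j\le l$; 11. $\mathbf 1\otimes(0,0,0,0,0,1)$ if $b_2=(0,0,0,0,0,1)$ and $j=1$; 12. $\mathbf 1\otimes(j-2,0,0,0,0,0)$ if $b_2=(0,0,0,0,0,1)$ and $2\le j\le l$. -/

import Mathlib

namespace G2Crystal

/-- The data of a crystal for `U_q'(G_2^{(1)})` with index set `I = {0,1,2} = Fin 3`.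
The classical weight lattice `ℤΛ₀ ⊕ ℤΛ₁ ⊕ ℤΛ₂` sits in `Fin 3 → ℚ`, a weight being given by its
coefficients, so that `⟨h_i, λ⟩ = λ i`.  The element `0` adjoined to the crystal is `none`.
(All values of `wt`, `eps`, `phi` below are integers; `ℚ` is used as ambient type since the
crystals are given in rational coordinates.) -/
structure CrystalData (X : Type) where
  wt : X → Fin 3 → ℚ
  e : Fin 3 → X → Option X
  f : Fin 3 → X → Option X
  eps : Fin 3 → X → ℚ
  phi : Fin 3 → X → ℚ

/-- The tensor product of crystals, on the set `X × Y`; `b₁ ⊗ 0 = 0 ⊗ b₂ = 0`. -/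
def CrystalData.tensor {X Y : Type} (C : CrystalData X) (D : CrystalData Y) :
    CrystalData (X × Y) where
  wt b := fun i => C.wt b.1 i + D.wt b.2 i
  e i b :=
    if D.eps i b.2 ≤ C.phi i b.1 then (C.e i b.1).map (fun a => (a, b.2))
    else (D.e i b.2).map (fun a => (b.1, a))
  f i b :=
    if D.eps i b.2 < C.phi i b.1 then (C.f i b.1).map (fun a => (a, b.2))
    else (D.f i b.2).map (fun a => (b.1, a))
  eps i b := max (C.eps i b.1) (D.eps i b.2 - C.wt b.1 i)
  phi i b := max (D.phi i b.2) (C.phi i b.1 + D.wt b.2 i)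

/-- Crystal isomorphisms `Ψ : X ∪ {0} → Y ∪ {0}`. -/
structure IsCrystalIso {X Y : Type} (C : CrystalData X) (D : CrystalData Y)
    (Ψ : Option X → Option Y) : Prop where
  bijective : Function.Bijective Ψ
  map_zero : Ψ none = none
  map_wt : ∀ (b : X) (c : Y), Ψ (some b) = some c → D.wt c = C.wt b
  map_eps : ∀ (b : X) (c : Y), Ψ (some b) = some c → ∀ i, D.eps i c = C.eps i b
  map_phi : ∀ (b : X) (c : Y), Ψ (some b) = some c → ∀ i, D.phi i c = C.phi i b
  map_arrow : ∀ (b b' : X) (c c' : Y), Ψ (some b) = some c → Ψ (some b') = some c' →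
    ∀ i, C.f i b = some b' → D.f i c = some c' ∧ D.e i c' = some c

/-- A six-tuple `(x₁, x₂, x₃, x̄₃, x̄₂, x̄₁)` of rationals; `y₃, y₂, y₁` are the barred ones. -/
@[ext]
structure Coord where
  x₁ : ℚ
  x₂ : ℚ
  x₃ : ℚ
  y₃ : ℚ
  y₂ : ℚ
  y₁ : ℚ

/-- Being an integer. -/
def IsInt (q : ℚ) : Prop := ∃ n : ℤ, q = n

/-- Being an element of `ℤ_{≥0}/3`. -/
def IsThird (q : ℚ) : Prop := ∃ n : ℕ, 3 * q = n

namespace Coord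

/-- `s(b)`, the sum `∑_{i=1,2} (x_i + x̄_i) + (x₃ + x̄₃)/2`. -/
def s (b : Coord) : ℚ := b.x₁ + b.x₂ + (b.x₃ + b.y₃) / 2 + b.y₂ + b.y₁

def z₁ (b : Coord) : ℚ := b.y₁ - b.x₁
def z₂ (b : Coord) : ℚ := b.y₂ - b.y₃
def z₃ (b : Coord) : ℚ := b.x₃ - b.x₂
def z₄ (b : Coord) : ℚ := (b.y₃ - b.x₃) / 2

/-- Membership in the set `B_l`. -/
structure Mem (l : ℕ) (b : Coord) : Prop where
  third_x₁ : IsThird b.x₁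
  third_x₂ : IsThird b.x₂
  third_x₃ : IsThird b.x₃
  third_y₃ : IsThird b.y₃
  third_y₂ : IsThird b.y₂
  third_y₁ : IsThird b.y₁
  /-- `3 x₃ ≡ 3 x̄₃ (mod 2)` -/
  parity : IsInt ((3 * b.x₃ - 3 * b.y₃) / 2)
  sum_le : b.s ≤ l
  int_x₁ : IsInt b.x₁
  int_y₁ : IsInt b.y₁
  int_x₂_sub_x₃ : IsInt (b.x₂ - b.x₃)
  int_y₃_sub_y₂ : IsInt (b.y₃ - b.y₂)

/-- The conditions `(F_1)`-`(F_6)`. -/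
def F₁ (b : Coord) : Prop :=
  b.z₁ + b.z₂ + b.z₃ + 3 * b.z₄ ≤ 0 ∧ b.z₁ + b.z₂ + 3 * b.z₄ ≤ 0 ∧ b.z₁ + b.z₂ ≤ 0 ∧ b.z₁ ≤ 0
def F₂ (b : Coord) : Prop :=
  b.z₁ + b.z₂ + b.z₃ + 3 * b.z₄ ≤ 0 ∧ b.z₂ + 3 * b.z₄ ≤ 0 ∧ b.z₂ ≤ 0 ∧ 0 < b.z₁
def F₃ (b : Coord) : Prop :=
  b.z₁ + b.z₃ + 3 * b.z₄ ≤ 0 ∧ b.z₃ + 3 * b.z₄ ≤ 0 ∧ b.z₄ ≤ 0 ∧ 0 < b.z₂ ∧ 0 < b.z₁ + b.z₂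
def F₄ (b : Coord) : Prop :=
  0 < b.z₁ + b.z₂ + 3 * b.z₄ ∧ 0 < b.z₂ + 3 * b.z₄ ∧ 0 < b.z₄ ∧ b.z₃ ≤ 0 ∧ b.z₁ + b.z₃ ≤ 0
def F₅ (b : Coord) : Prop :=
  0 < b.z₁ + b.z₂ + b.z₃ + 3 * b.z₄ ∧ 0 < b.z₃ + 3 * b.z₄ ∧ 0 < b.z₃ ∧ b.z₁ ≤ 0
def F₆ (b : Coord) : Prop :=
  0 < b.z₁ + b.z₂ + b.z₃ + 3 * b.z₄ ∧ 0 < b.z₁ + b.z₃ + 3 * b.z₄ ∧ 0 < b.z₁ + b.z₃ ∧ 0 < b.z₁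

/-- The conditions `(E_1)`-`(E_6)`: replace `>` by `≥` and `≤` by `<` in `(F_1)`-`(F_6)`. -/
def E₁ (b : Coord) : Prop :=
  b.z₁ + b.z₂ + b.z₃ + 3 * b.z₄ < 0 ∧ b.z₁ + b.z₂ + 3 * b.z₄ < 0 ∧ b.z₁ + b.z₂ < 0 ∧ b.z₁ < 0
def E₂ (b : Coord) : Prop :=
  b.z₁ + b.z₂ + b.z₃ + 3 * b.z₄ < 0 ∧ b.z₂ + 3 * b.z₄ < 0 ∧ b.z₂ < 0 ∧ 0 ≤ b.z₁
def E₃ (b : Coord) : Prop :=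
  b.z₁ + b.z₃ + 3 * b.z₄ < 0 ∧ b.z₃ + 3 * b.z₄ < 0 ∧ b.z₄ < 0 ∧ 0 ≤ b.z₂ ∧ 0 ≤ b.z₁ + b.z₂
def E₄ (b : Coord) : Prop :=
  0 ≤ b.z₁ + b.z₂ + 3 * b.z₄ ∧ 0 ≤ b.z₂ + 3 * b.z₄ ∧ 0 ≤ b.z₄ ∧ b.z₃ < 0 ∧ b.z₁ + b.z₃ < 0
def E₅ (b : Coord) : Prop :=
  0 ≤ b.z₁ + b.z₂ + b.z₃ + 3 * b.z₄ ∧ 0 ≤ b.z₃ + 3 * b.z₄ ∧ 0 ≤ b.z₃ ∧ b.z₁ < 0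
def E₆ (b : Coord) : Prop :=
  0 ≤ b.z₁ + b.z₂ + b.z₃ + 3 * b.z₄ ∧ 0 ≤ b.z₁ + b.z₃ + 3 * b.z₄ ∧ 0 ≤ b.z₁ + b.z₃ ∧ 0 ≤ b.z₁

open Classical in
/-- The tuple that `ẽ_0` produces, before testing whether it lies in `B_l`.
For every tuple exactly one of `(E_1)`-`(E_6)` holds, so the last `none` is never reached. -/
noncomputable def rawE₀ (b : Coord) : Option Coord :=
  if b.E₁ then some { b with x₁ := b.x₁ - 1 }
  else if b.E₂ then some { b with x₃ := b.x₃ - 1, y₃ := b.y₃ - 1, y₁ := b.y₁ + 1 }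
  else if b.E₃ then
    if b.z₄ = -(1 / 3) then
      some { b with x₂ := b.x₂ - 2 / 3, x₃ := b.x₃ - 2 / 3, y₃ := b.y₃ + 4 / 3, y₂ := b.y₂ + 1 / 3 }
    else if b.z₄ = -(2 / 3) then
      some { b with x₂ := b.x₂ - 1 / 3, x₃ := b.x₃ - 4 / 3, y₃ := b.y₃ + 2 / 3, y₂ := b.y₂ + 2 / 3 }
    else some { b with x₃ := b.x₃ - 2, y₂ := b.y₂ + 1 }
  else if b.E₄ then some { b with x₂ := b.x₂ - 1, y₃ := b.y₃ + 2 }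
  else if b.E₅ then some { b with x₁ := b.x₁ - 1, x₃ := b.x₃ + 1, y₃ := b.y₃ + 1 }
  else if b.E₆ then some { b with y₁ := b.y₁ + 1 }
  else none

open Classical in
/-- The tuple that `f̃_0` produces, before testing whether it lies in `B_l`.
For every tuple exactly one of `(F_1)`-`(F_6)` holds, so the last `none` is never reached. -/
noncomputable def rawF₀ (b : Coord) : Option Coord :=
  if b.F₁ then some { b with x₁ := b.x₁ + 1 }
  else if b.F₂ then some { b with x₃ := b.x₃ + 1, y₃ := b.y₃ + 1, y₁ := b.y₁ - 1 }
  else if b.F₃ then some { b with x₃ := b.x₃ + 2, y₂ := b.y₂ - 1 }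
  else if b.F₄ then
    if b.z₄ = 1 / 3 then
      some { b with x₂ := b.x₂ + 1 / 3, x₃ := b.x₃ + 4 / 3, y₃ := b.y₃ - 2 / 3, y₂ := b.y₂ - 2 / 3 }
    else if b.z₄ = 2 / 3 then
      some { b with x₂ := b.x₂ + 2 / 3, x₃ := b.x₃ + 2 / 3, y₃ := b.y₃ - 4 / 3, y₂ := b.y₂ - 1 / 3 }
    else some { b with x₂ := b.x₂ + 1, y₃ := b.y₃ - 2 }
  else if b.F₅ then some { b with x₁ := b.x₁ + 1, x₃ := b.x₃ - 1, y₃ := b.y₃ - 1 }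
  else if b.F₆ then some { b with y₁ := b.y₁ - 1 }
  else none

/-- The tuple that `ẽ_1` produces; the three cases are exhaustive and mutually exclusive. -/
noncomputable def rawE₁ (b : Coord) : Option Coord :=
  if max (-b.z₃) 0 ≤ b.z₂ then some { b with y₂ := b.y₂ + 1, y₁ := b.y₁ - 1 }
  else if b.z₂ < 0 ∧ 0 ≤ b.z₃ then some { b with x₃ := b.x₃ + 1, y₃ := b.y₃ - 1 }
  else if max b.z₂ 0 < -b.z₃ then some { b with x₁ := b.x₁ + 1, x₂ := b.x₂ - 1 }
  else none

/-- The tuple that `f̃_1` produces; the three cases are exhaustive and mutually exclusive. -/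
noncomputable def rawF₁ (b : Coord) : Option Coord :=
  if max b.z₂ 0 ≤ -b.z₃ then some { b with x₁ := b.x₁ - 1, x₂ := b.x₂ + 1 }
  else if b.z₂ ≤ 0 ∧ 0 < b.z₃ then some { b with x₃ := b.x₃ - 1, y₃ := b.y₃ + 1 }
  else if max (-b.z₃) 0 < b.z₂ then some { b with y₂ := b.y₂ - 1, y₁ := b.y₁ + 1 }
  else none

noncomputable def rawE₂ (b : Coord) : Option Coord :=
  if 0 ≤ b.z₄ then some { b with y₃ := b.y₃ + 2 / 3, y₂ := b.y₂ - 1 / 3 }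
  else some { b with x₂ := b.x₂ + 1 / 3, x₃ := b.x₃ - 2 / 3 }

noncomputable def rawF₂ (b : Coord) : Option Coord :=
  if b.z₄ ≤ 0 then some { b with x₂ := b.x₂ - 1 / 3, x₃ := b.x₃ + 2 / 3 }
  else some { b with y₃ := b.y₃ - 2 / 3, y₂ := b.y₂ + 1 / 3 }

noncomputable def rawE : Fin 3 → Coord → Option Coord
  | 0 => rawE₀
  | 1 => rawE₁
  | 2 => rawE₂

noncomputable def rawF : Fin 3 → Coord → Option Coord
  | 0 => rawF₀
  | 1 => rawF₁
  | 2 => rawF₂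

/-- The maximum of the set
`A = {0, z₁, z₁+z₂, z₁+z₂+3z₄, z₁+z₂+z₃+3z₄, 2z₁+z₂+z₃+3z₄}`. -/
def maxA (b : Coord) : ℚ :=
  max 0 (max b.z₁ (max (b.z₁ + b.z₂) (max (b.z₁ + b.z₂ + 3 * b.z₄)
    (max (b.z₁ + b.z₂ + b.z₃ + 3 * b.z₄) (2 * b.z₁ + b.z₂ + b.z₃ + 3 * b.z₄)))))

/-- `ε_i` at level `l`. -/
def eps (l : ℕ) : Fin 3 → Coord → ℚ
  | 0, b => l - b.s + b.maxA - (2 * b.z₁ + b.z₂ + b.z₃ + 3 * b.z₄)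
  | 1, b => b.y₁ + max (b.y₃ - b.y₂ + max (b.x₂ - b.x₃) 0) 0
  | 2, b => 3 * b.y₂ + 3 / 2 * max (b.x₃ - b.y₃) 0

/-- `φ_i` at level `l`. -/
def phi (l : ℕ) : Fin 3 → Coord → ℚ
  | 0, b => l - b.s + b.maxA
  | 1, b => b.x₁ + max (b.x₃ - b.x₂ + max (b.y₂ - b.y₃) 0) 0
  | 2, b => 3 * b.x₂ + 3 / 2 * max (b.y₃ - b.x₃) 0

end Coord

/-- The set `B_l`. -/
def B (l : ℕ) : Type := {b : Coord // b.Mem l}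

open Classical in
/-- A tuple regarded as an element of `B_l ∪ {0}`: it is `0` if it does not lie in `B_l`. -/
noncomputable def toB (l : ℕ) (c : Coord) : Option (B l) :=
  if h : c.Mem l then some ⟨c, h⟩ else none

/-- The `U_q'(G_2^{(1)})`-crystal `B_l`.  The weight is the one forced by
`φ_i(b) = ε_i(b) + ⟨h_i, wt b⟩`, i.e. `wt b = ∑_i (φ_i(b) - ε_i(b)) Λ_i`. -/
noncomputable def crystal (l : ℕ) : CrystalData (B l) where
  wt b := fun i => b.1.phi l i - b.1.eps l i
  e i b := (b.1.rawE i).bind (toB l)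
  f i b := (b.1.rawF i).bind (toB l)
  eps i b := b.1.eps l i
  phi i b := b.1.phi l i

/-- `R (u ⊗ v) = u' ⊗ v'` for tuples `u, v, u', v'` and a map
`R : (B_l ⊗ B_m) ∪ {0} → (B_m ⊗ B_l) ∪ {0}`; this includes that `u, v'` lie in `B_l` and
`v, u'` lie in `B_m`. -/
def Sends {l m : ℕ} (R : Option (B l × B m) → Option (B m × B l)) (u v u' v' : Coord) : Prop :=
  ∃ (hu : u.Mem l) (hv : v.Mem m) (hu' : u'.Mem m) (hv' : v'.Mem l),
    R (some (⟨u, hu⟩, ⟨v, hv⟩)) = some (⟨u', hu'⟩, ⟨v', hv'⟩)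

end G2Crystal

/-!
A crystal isomorphism preserves `εᵢ` and `φᵢ`, and every element `(j,0,0,0,0,0) ⊗ b₂` in question
is *highest*, i.e. has `ε₁ = ε₂ = 0`. So its image is a highest element of `B_1 ⊗ B_l` with the same
`φ₀, φ₁, φ₂`, and it remains to see which these are.

For a highest element `u ⊗ v` of any tensor product, `ε_i(u) ≤ ε_i(u ⊗ v)` forces
`ε₁(u) = ε₂(u) = 0`, hence `u = (a,0,0,0,0,0)` (`Coord.eq_row_of_eps_nonpos`), and then `ε₂(v) = 0`
and `ε₁(v) ≤ a`. For `u ∈ B_1` we have `a ≤ 1`, and integrality leaves six one-parameter families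
for `v` (`Coord.eq_of_eps_le_one`). The resulting list `IsHighest.cases` of highest elements
of `B_1 ⊗ B_l` contains all the asserted images, and `(φ₀, φ₁, φ₂)` separates its members, except
that `0 ⊗ (j,0,0,0,0,0)` and `1 ⊗ (j-1,0,1,1,0,0)` have equal values.

This ambiguity is resolved by `f̃₀`. The image of `0 ⊗ 0` is unambiguous, and
`f̃₀` increases `j` in `(j,0,0,0,0,0) ⊗ 0` and in `0 ⊗ (j,0,0,0,0,0)` until `j = l - 1`
(`sends_row_zero`); one more application turns `(l-1,0,0,0,0,0) ⊗ 0` into `(l-1,0,0,0,0,0) ⊗ 1` and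
its image into `0 ⊗ (l,0,0,0,0,0)` (`sends_penultimate_one`). As the values
`0 ⊗ (j,0,0,0,0,0)` are thus taken, injectivity gives the image of `(j,0,0,0,0,0) ⊗ (0,0,1,1,0,0)`
(`sends_row_x₃_y₃`).
-/

namespace G2Crystal

theorem IsThird.nonneg {q : ℚ} (h : IsThird q) : 0 ≤ q := by
  obtain ⟨n, hn⟩ := h
  have : (0 : ℚ) ≤ n := n.cast_nonneg
  linarith

theorem IsInt.exists_nat {q : ℚ} (h : IsInt q) (h0 : 0 ≤ q) : ∃ n : ℕ, q = n := by
  obtain ⟨n, rfl⟩ := h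
  lift n to ℕ using (by exact_mod_cast h0)
  exact ⟨n, by simp⟩

namespace Coord

/-! ### String lengths of the tuples that occur -/

theorem strings_row (l : ℕ) {t : ℚ} (ht : 0 ≤ t) :
    eps l 0 ⟨t, 0, 0, 0, 0, 0⟩ = l + t ∧ phi l 0 ⟨t, 0, 0, 0, 0, 0⟩ = l - t ∧
    eps l 1 ⟨t, 0, 0, 0, 0, 0⟩ = 0 ∧ phi l 1 ⟨t, 0, 0, 0, 0, 0⟩ = t ∧
    eps l 2 ⟨t, 0, 0, 0, 0, 0⟩ = 0 ∧ phi l 2 ⟨t, 0, 0, 0, 0, 0⟩ = 0 := by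
  have hA : maxA ⟨t, 0, 0, 0, 0, 0⟩ = 0 := by
    simp [maxA, z₁, z₂, z₃, z₄, ht]
  simp [eps, phi, hA, s, z₁, z₂, z₃, z₄]
  ring

theorem strings_x₂ (l : ℕ) {t : ℚ} (ht : 0 ≤ t) :
    eps l 0 ⟨t, 1, 0, 0, 0, 0⟩ = l + t ∧ phi l 0 ⟨t, 1, 0, 0, 0, 0⟩ = l - t - 1 ∧
    eps l 1 ⟨t, 1, 0, 0, 0, 0⟩ = 1 ∧ phi l 1 ⟨t, 1, 0, 0, 0, 0⟩ = t ∧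
    eps l 2 ⟨t, 1, 0, 0, 0, 0⟩ = 0 ∧ phi l 2 ⟨t, 1, 0, 0, 0, 0⟩ = 3 := by
  have hA : maxA ⟨t, 1, 0, 0, 0, 0⟩ = 0 := by
    refine max_eq_left (max_le ?_ (max_le ?_ (max_le ?_ (max_le ?_ ?_)))) <;>
      norm_num [z₁, z₂, z₃, z₄] <;> linarith
  norm_num [eps, phi, hA, s, z₁, z₂, z₃, z₄]
  constructor <;> ring

theorem strings_x₃_y₃ (l : ℕ) {t : ℚ} (ht : 0 ≤ t) :
    eps l 0 ⟨t, 0, 1, 1, 0, 0⟩ = l + t - 1 ∧ phi l 0 ⟨t, 0, 1, 1, 0, 0⟩ = l - t - 1 ∧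
    eps l 1 ⟨t, 0, 1, 1, 0, 0⟩ = 1 ∧ phi l 1 ⟨t, 0, 1, 1, 0, 0⟩ = t + 1 ∧
    eps l 2 ⟨t, 0, 1, 1, 0, 0⟩ = 0 ∧ phi l 2 ⟨t, 0, 1, 1, 0, 0⟩ = 0 := by
  have hA : maxA ⟨t, 0, 1, 1, 0, 0⟩ = 0 := by
    refine max_eq_left (max_le ?_ (max_le ?_ (max_le ?_ (max_le ?_ ?_)))) <;>
      norm_num [z₁, z₂, z₃, z₄] <;> linarith
  norm_num [eps, phi, hA, s, z₁, z₂, z₃, z₄]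
  constructor <;> ring

theorem strings_x₂_x₃_y₃ (l : ℕ) {t : ℚ} (ht : 0 ≤ t) :
    eps l 0 ⟨t, 1, 1, 1, 0, 0⟩ = l + t - 1 ∧ phi l 0 ⟨t, 1, 1, 1, 0, 0⟩ = l - t - 2 ∧
    eps l 1 ⟨t, 1, 1, 1, 0, 0⟩ = 1 ∧ phi l 1 ⟨t, 1, 1, 1, 0, 0⟩ = t ∧
    eps l 2 ⟨t, 1, 1, 1, 0, 0⟩ = 0 ∧ phi l 2 ⟨t, 1, 1, 1, 0, 0⟩ = 3 := by
  have hA : maxA ⟨t, 1, 1, 1, 0, 0⟩ = 0 := by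
    refine max_eq_left (max_le ?_ (max_le ?_ (max_le ?_ (max_le ?_ ?_)))) <;>
      norm_num [z₁, z₂, z₃, z₄] <;> linarith
  norm_num [eps, phi, hA, s, z₁, z₂, z₃, z₄]
  constructor <;> ring

theorem strings_third (l : ℕ) {t : ℚ} (ht : 0 ≤ t) :
    eps l 0 ⟨t, 1 / 3, 1 / 3, 1, 0, 0⟩ = l + t - 1 ∧
    phi l 0 ⟨t, 1 / 3, 1 / 3, 1, 0, 0⟩ = l - t - 1 ∧
    eps l 1 ⟨t, 1 / 3, 1 / 3, 1, 0, 0⟩ = 1 ∧ phi l 1 ⟨t, 1 / 3, 1 / 3, 1, 0, 0⟩ = t ∧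
    eps l 2 ⟨t, 1 / 3, 1 / 3, 1, 0, 0⟩ = 0 ∧ phi l 2 ⟨t, 1 / 3, 1 / 3, 1, 0, 0⟩ = 2 := by
  have hA : maxA ⟨t, 1 / 3, 1 / 3, 1, 0, 0⟩ = 0 := by
    refine max_eq_left (max_le ?_ (max_le ?_ (max_le ?_ (max_le ?_ ?_)))) <;>
      norm_num [z₁, z₂, z₃, z₄] <;> linarith
  norm_num [eps, phi, hA, s, z₁, z₂, z₃, z₄]
  constructor <;> ring

/-- The case `t = 0` is different, see `strings_y₁`: there `maxA` is `2` instead of `0`. -/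
theorem strings_y₁_of_one_le (l : ℕ) {t : ℚ} (ht : 1 ≤ t) :
    eps l 0 ⟨t, 0, 0, 0, 0, 1⟩ = l + t - 3 ∧ phi l 0 ⟨t, 0, 0, 0, 0, 1⟩ = l - t - 1 ∧
    eps l 1 ⟨t, 0, 0, 0, 0, 1⟩ = 1 ∧ phi l 1 ⟨t, 0, 0, 0, 0, 1⟩ = t ∧
    eps l 2 ⟨t, 0, 0, 0, 0, 1⟩ = 0 ∧ phi l 2 ⟨t, 0, 0, 0, 0, 1⟩ = 0 := by
  have hA : maxA ⟨t, 0, 0, 0, 0, 1⟩ = 0 := by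
    refine max_eq_left (max_le ?_ (max_le ?_ (max_le ?_ (max_le ?_ ?_)))) <;>
      norm_num [z₁, z₂, z₃, z₄] <;> linarith
  norm_num [eps, phi, hA, s, z₁, z₂, z₃, z₄]
  constructor <;> ring

theorem strings_y₁ (l : ℕ) :
    eps l 0 ⟨0, 0, 0, 0, 0, 1⟩ = l - 1 ∧ phi l 0 ⟨0, 0, 0, 0, 0, 1⟩ = l + 1 ∧
    eps l 1 ⟨0, 0, 0, 0, 0, 1⟩ = 1 ∧ phi l 1 ⟨0, 0, 0, 0, 0, 1⟩ = 0 ∧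
    eps l 2 ⟨0, 0, 0, 0, 0, 1⟩ = 0 ∧ phi l 2 ⟨0, 0, 0, 0, 0, 1⟩ = 0 := by
  norm_num [eps, phi, maxA, s, z₁, z₂, z₃, z₄]
  ring

theorem strings_y₃ (l : ℕ) :
    eps l 0 ⟨0, 0, 0, 2, 0, 0⟩ = l - 1 ∧ phi l 0 ⟨0, 0, 0, 2, 0, 0⟩ = l ∧
    eps l 1 ⟨0, 0, 0, 2, 0, 0⟩ = 2 ∧ phi l 1 ⟨0, 0, 0, 2, 0, 0⟩ = 0 ∧
    eps l 2 ⟨0, 0, 0, 2, 0, 0⟩ = 0 ∧ phi l 2 ⟨0, 0, 0, 2, 0, 0⟩ = 3 := by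
  norm_num [eps, phi, maxA, s, z₁, z₂, z₃, z₄]

/-! ### Membership in `B_l` -/

theorem mem_row {l j : ℕ} (h : j ≤ l) : Mem l ⟨j, 0, 0, 0, 0, 0⟩ where
  third_x₁ := ⟨3 * j, by push_cast; rfl⟩
  third_x₂ := ⟨0, by simp⟩
  third_x₃ := ⟨0, by simp⟩
  third_y₃ := ⟨0, by simp⟩
  third_y₂ := ⟨0, by simp⟩
  third_y₁ := ⟨0, by simp⟩
  parity := ⟨0, by simp⟩
  sum_le := by simpa [s] using h
  int_x₁ := ⟨j, by simp⟩
  int_y₁ := ⟨0, by simp⟩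
  int_x₂_sub_x₃ := ⟨0, by simp⟩
  int_y₃_sub_y₂ := ⟨0, by simp⟩

theorem mem_x₂ : Mem 1 ⟨0, 1, 0, 0, 0, 0⟩ := by
  refine ⟨⟨0, ?_⟩, ⟨3, ?_⟩, ⟨0, ?_⟩, ⟨0, ?_⟩, ⟨0, ?_⟩, ⟨0, ?_⟩, ⟨0, ?_⟩, ?_, ⟨0, ?_⟩, ⟨0, ?_⟩,
    ⟨1, ?_⟩, ⟨0, ?_⟩⟩ <;> norm_num [s]

theorem mem_third : Mem 1 ⟨0, 1 / 3, 1 / 3, 1, 0, 0⟩ := by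
  refine ⟨⟨0, ?_⟩, ⟨1, ?_⟩, ⟨1, ?_⟩, ⟨3, ?_⟩, ⟨0, ?_⟩, ⟨0, ?_⟩, ⟨-1, ?_⟩, ?_, ⟨0, ?_⟩, ⟨0, ?_⟩,
    ⟨0, ?_⟩, ⟨1, ?_⟩⟩ <;> norm_num [s]

theorem mem_x₃_y₃ : Mem 1 ⟨0, 0, 1, 1, 0, 0⟩ := by
  refine ⟨⟨0, ?_⟩, ⟨0, ?_⟩, ⟨3, ?_⟩, ⟨3, ?_⟩, ⟨0, ?_⟩, ⟨0, ?_⟩, ⟨0, ?_⟩, ?_, ⟨0, ?_⟩, ⟨0, ?_⟩,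
    ⟨-1, ?_⟩, ⟨1, ?_⟩⟩ <;> norm_num [s]

theorem mem_y₃ : Mem 1 ⟨0, 0, 0, 2, 0, 0⟩ := by
  refine ⟨⟨0, ?_⟩, ⟨0, ?_⟩, ⟨0, ?_⟩, ⟨6, ?_⟩, ⟨0, ?_⟩, ⟨0, ?_⟩, ⟨-3, ?_⟩, ?_, ⟨0, ?_⟩, ⟨0, ?_⟩,
    ⟨0, ?_⟩, ⟨2, ?_⟩⟩ <;> norm_num [s]

theorem mem_y₁ : Mem 1 ⟨0, 0, 0, 0, 0, 1⟩ := by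
  refine ⟨⟨0, ?_⟩, ⟨0, ?_⟩, ⟨0, ?_⟩, ⟨0, ?_⟩, ⟨0, ?_⟩, ⟨3, ?_⟩, ⟨0, ?_⟩, ?_, ⟨0, ?_⟩, ⟨1, ?_⟩,
    ⟨0, ?_⟩, ⟨0, ?_⟩⟩ <;> norm_num [s]

/-! ### Tuples with small `ε₁` and vanishing `ε₂` -/

/-- An element with `ε₁ = ε₂ = 0` is determined by its first coordinate; the hypotheses are
inequalities because both values are nonnegative anyway. -/
theorem eq_row_of_eps_nonpos {l : ℕ} {b : Coord} (hb : b.Mem l)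
    (h₁ : b.eps l 1 ≤ 0) (h₂ : b.eps l 2 ≤ 0) :
    ∃ t : ℕ, t ≤ l ∧ b = ⟨t, 0, 0, 0, 0, 0⟩ := by
  obtain ⟨t, ht⟩ := hb.int_x₁.exists_nat hb.third_x₁.nonneg
  have := hb.third_x₂.nonneg
  have := hb.third_x₃.nonneg
  have := hb.third_y₃.nonneg
  have := hb.third_y₂.nonneg
  have := hb.third_y₁.nonneg
  have hs := hb.sum_le
  simp only [eps] at h₁ h₂
  have := le_max_right (b.x₃ - b.y₃) 0
  have := le_max_left (b.x₃ - b.y₃) 0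
  have := le_max_right (b.x₂ - b.x₃) 0
  have := le_max_left (b.x₂ - b.x₃) 0
  have := le_max_right (b.y₃ - b.y₂ + max (b.x₂ - b.x₃) 0) 0
  have := le_max_left (b.y₃ - b.y₂ + max (b.x₂ - b.x₃) 0) 0
  have e2 : b.x₂ = 0 := by linarith
  have e3 : b.x₃ = 0 := by linarith
  have e4 : b.y₃ = 0 := by linarith
  have e5 : b.y₂ = 0 := by linarith
  have e6 : b.y₁ = 0 := by linarith
  refine ⟨t, ?_, Coord.ext ht e2 e3 e4 e5 e6⟩
  simp only [s, e2, e3, e4, e5, e6, ht] at hs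
  have : (t : ℚ) ≤ l := by linarith
  exact_mod_cast this

/-- The possible second factors of a highest element of `B_1 ⊗ B_l`. -/
theorem eq_of_eps_le_one {l : ℕ} {b : Coord} (hb : b.Mem l)
    (h₁ : b.eps l 1 ≤ 1) (h₂ : b.eps l 2 ≤ 0) :
    ∃ t : ℕ, b = ⟨t, 0, 0, 0, 0, 0⟩ ∨ b = ⟨t, 0, 0, 0, 0, 1⟩ ∨ b = ⟨t, 1, 0, 0, 0, 0⟩ ∨
      b = ⟨t, 0, 1, 1, 0, 0⟩ ∨ b = ⟨t, 1, 1, 1, 0, 0⟩ ∨ b = ⟨t, 1 / 3, 1 / 3, 1, 0, 0⟩ := by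
  obtain ⟨t, ht⟩ := hb.int_x₁.exists_nat hb.third_x₁.nonneg
  obtain ⟨u, hu⟩ := hb.int_y₁.exists_nat hb.third_y₁.nonneg
  obtain ⟨n2, hn2⟩ := hb.third_x₂
  obtain ⟨n3, hn3⟩ := hb.third_x₃
  have e2 : b.x₂ = n2 / 3 := by linarith
  have e3 : b.x₃ = n3 / 3 := by linarith
  obtain ⟨w, hw⟩ := hb.int_x₂_sub_x₃
  obtain ⟨v, hv⟩ := hb.int_y₃_sub_y₂
  obtain ⟨p, hp⟩ := hb.parity
  have := hb.third_x₂.nonneg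
  have := hb.third_x₃.nonneg
  have := hb.third_y₃.nonneg
  have := hb.third_y₂.nonneg
  have := hb.third_y₁.nonneg
  simp only [eps] at h₁ h₂
  have := le_max_right (b.x₃ - b.y₃) 0
  have := le_max_left (b.x₃ - b.y₃) 0
  have := le_max_right (b.x₂ - b.x₃) 0
  have := le_max_left (b.x₂ - b.x₃) 0
  have := le_max_right (b.y₃ - b.y₂ + max (b.x₂ - b.x₃) 0) 0
  have := le_max_left (b.y₃ - b.y₂ + max (b.x₂ - b.x₃) 0) 0
  have e5 : b.y₂ = 0 := by linarith
  have e4 : b.y₃ = v := by linarith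
  -- in units of `1/3`, the conditions become linear inequalities between integers
  have i1 : (n3 : ℤ) ≤ 3 * v := by
    have : (n3 : ℚ) ≤ 3 * v := by linarith
    exact_mod_cast this
  have i2 : (u : ℤ) + v ≤ 1 := by
    have : (u : ℚ) + v ≤ 1 := by linarith
    exact_mod_cast this
  have i3 : (u : ℤ) + v + w ≤ 1 := by
    have : (u : ℚ) + v + w ≤ 1 := by linarith
    exact_mod_cast this
  have i4 : (n3 : ℤ) - 3 * v = 2 * p := by
    have : (n3 : ℚ) - 3 * v = 2 * p := by linarith
    exact_mod_cast this
  have i5 : (n2 : ℤ) - n3 = 3 * w := by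
    have : (n2 : ℚ) - n3 = 3 * w := by linarith
    exact_mod_cast this
  have key : (u = 0 ∧ v = 0 ∧ n2 = 0 ∧ n3 = 0) ∨ (u = 1 ∧ v = 0 ∧ n2 = 0 ∧ n3 = 0) ∨
      (u = 0 ∧ v = 0 ∧ n2 = 3 ∧ n3 = 0) ∨ (u = 0 ∧ v = 1 ∧ n2 = 0 ∧ n3 = 3) ∨
      (u = 0 ∧ v = 1 ∧ n2 = 3 ∧ n3 = 3) ∨ (u = 0 ∧ v = 1 ∧ n2 = 1 ∧ n3 = 1) := by
    have : v = 0 ∨ v = 1 := by omega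
    have : u = 0 ∨ u = 1 := by omega
    omega
  refine ⟨t, ?_⟩
  rcases key with h | h | h | h | h | h <;> obtain ⟨rfl, rfl, rfl, rfl⟩ := h <;>
    push_cast at e2 e3 e4 hu
  · exact .inl (Coord.ext ht (e2.trans (by norm_num)) (e3.trans (by norm_num)) e4 e5 hu)
  · exact .inr <| .inl
      (Coord.ext ht (e2.trans (by norm_num)) (e3.trans (by norm_num)) e4 e5 hu)
  · exact .inr <| .inr <| .inl
      (Coord.ext ht (e2.trans (by norm_num)) (e3.trans (by norm_num)) e4 e5 hu)
  · exact .inr <| .inr <| .inr <| .inl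
      (Coord.ext ht (e2.trans (by norm_num)) (e3.trans (by norm_num)) e4 e5 hu)
  · exact .inr <| .inr <| .inr <| .inr <| .inl
      (Coord.ext ht (e2.trans (by norm_num)) (e3.trans (by norm_num)) e4 e5 hu)
  · exact .inr <| .inr <| .inr <| .inr <| .inr
      (Coord.ext ht (e2.trans (by norm_num)) (e3.trans (by norm_num)) e4 e5 hu)

end Coord

open Coord

/-! ### Highest elements of tensor products -/

/-- For `u = (a,0,0,0,0,0)`, the string lengths of `u ⊗ v` in terms of those of `v`. -/
theorem tensor_row {n m : ℕ} {u : B n} {v : B m} {a : ℚ} (ha : 0 ≤ a)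
    (hu : u.1 = ⟨a, 0, 0, 0, 0, 0⟩) :
    ((crystal n).tensor (crystal m)).eps 1 (u, v) = max 0 (v.1.eps m 1 - a) ∧
    ((crystal n).tensor (crystal m)).eps 2 (u, v) = max 0 (v.1.eps m 2) ∧
    ((crystal n).tensor (crystal m)).phi 0 (u, v) =
      max (v.1.phi m 0) (n - a + (v.1.phi m 0 - v.1.eps m 0)) ∧
    ((crystal n).tensor (crystal m)).phi 1 (u, v) =
      max (v.1.phi m 1) (a + (v.1.phi m 1 - v.1.eps m 1)) ∧
    ((crystal n).tensor (crystal m)).phi 2 (u, v) =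
      max (v.1.phi m 2) (v.1.phi m 2 - v.1.eps m 2) := by
  obtain ⟨h1, h2, h3, h4, h5, h6⟩ := strings_row n ha
  simp [CrystalData.tensor, crystal, hu, h2, h3, h4, h5, h6]

/-- `c` is highest for the index set `{1, 2}`, with `φᵢ(c) = pᵢ`. Highest is encoded as
`ε₁(c) = ε₂(c) = 0`, a condition visibly preserved by crystal isomorphisms, rather than as
`ẽ₁ c = ẽ₂ c = 0`. -/
structure IsHighest {X : Type} (C : CrystalData X) (c : X) (p₀ p₁ p₂ : ℚ) : Prop where
  eps_one : C.eps 1 c = 0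
  eps_two : C.eps 2 c = 0
  phi_zero : C.phi 0 c = p₀
  phi_one : C.phi 1 c = p₁
  phi_two : C.phi 2 c = p₂

theorem isHighest_tensor_row {n m : ℕ} {u : B n} {v : B m} {a e₀ p₀ e₁ p₁ p₂ q₀ q₁ : ℚ}
    (ha : 0 ≤ a) (hu : u.1 = ⟨a, 0, 0, 0, 0, 0⟩)
    (hv : v.1.eps m 0 = e₀ ∧ v.1.phi m 0 = p₀ ∧ v.1.eps m 1 = e₁ ∧ v.1.phi m 1 = p₁ ∧
      v.1.eps m 2 = 0 ∧ v.1.phi m 2 = p₂)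
    (h : e₁ ≤ a) (hq₀ : max p₀ (n - a + (p₀ - e₀)) = q₀) (hq₁ : a + (p₁ - e₁) = q₁) :
    IsHighest ((crystal n).tensor (crystal m)) (u, v) q₀ q₁ p₂ := by
  obtain ⟨h1, h2, h3, h4, h5⟩ := tensor_row (v := v) ha hu
  obtain ⟨g1, g2, g3, g4, g5, g6⟩ := hv
  refine ⟨?_, ?_, ?_, ?_, ?_⟩
  · rw [h1, g3]; exact max_eq_left (by linarith)
  · rw [h2, g5]; simp
  · rw [h3, g1, g2, hq₀]
  · rw [h4, g3, g4, hq₁]; exact max_eq_right (by linarith)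
  · rw [h5, g5, g6]; simp

theorem IsHighest.eq {X : Type} {C : CrystalData X} {c : X} {p₀ p₁ p₂ q₀ q₁ q₂ : ℚ}
    (h : IsHighest C c p₀ p₁ p₂) (h' : IsHighest C c q₀ q₁ q₂) :
    p₀ = q₀ ∧ p₁ = q₁ ∧ p₂ = q₂ :=
  ⟨h.phi_zero.symm.trans h'.phi_zero, h.phi_one.symm.trans h'.phi_one,
    h.phi_two.symm.trans h'.phi_two⟩

/-- The list of the highest elements of `B_1 ⊗ B_l`, with their `φ₀, φ₁, φ₂`. -/
theorem IsHighest.cases {l : ℕ} (hl : 1 ≤ l) {c : B 1 × B l} {p₀ p₁ p₂ : ℚ}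
    (hc : IsHighest ((crystal 1).tensor (crystal l)) c p₀ p₁ p₂) :
    ∃ t : ℚ, 0 ≤ t ∧
    (c.1.1 = ⟨0, 0, 0, 0, 0, 0⟩ ∧ c.2.1 = ⟨t, 0, 0, 0, 0, 0⟩ ∧ p₀ = l - t ∧ p₁ = t ∧ p₂ = 0 ∨
    c.1.1 = ⟨1, 0, 0, 0, 0, 0⟩ ∧
      (c.2.1 = ⟨t, 0, 0, 0, 0, 0⟩ ∧ p₀ = l - t ∧ p₁ = t + 1 ∧ p₂ = 0 ∨
      c.2.1 = ⟨t, 0, 0, 0, 0, 1⟩ ∧ 1 ≤ t ∧ p₀ = l - t - 1 ∧ p₁ = t ∧ p₂ = 0 ∨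
      c.2.1 = ⟨0, 0, 0, 0, 0, 1⟩ ∧ p₀ = l + 1 ∧ p₁ = 0 ∧ p₂ = 0 ∨
      c.2.1 = ⟨t, 1, 0, 0, 0, 0⟩ ∧ p₀ = l - t - 1 ∧ p₁ = t ∧ p₂ = 3 ∨
      c.2.1 = ⟨t, 0, 1, 1, 0, 0⟩ ∧ p₀ = l - t - 1 ∧ p₁ = t + 1 ∧ p₂ = 0 ∨
      c.2.1 = ⟨t, 1, 1, 1, 0, 0⟩ ∧ p₀ = l - t - 2 ∧ p₁ = t ∧ p₂ = 3 ∨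
      c.2.1 = ⟨t, 1 / 3, 1 / 3, 1, 0, 0⟩ ∧ p₀ = l - t - 1 ∧ p₁ = t ∧ p₂ = 2)) := by
  have hlQ : (1 : ℚ) ≤ l := by exact_mod_cast hl
  obtain ⟨u, v⟩ := c
  -- the first factor of a highest weight element is itself of highest weight
  obtain ⟨a, hal, ha⟩ : ∃ a : ℕ, a ≤ 1 ∧ u.1 = ⟨a, 0, 0, 0, 0, 0⟩ :=
    eq_row_of_eps_nonpos u.2 ((le_max_left _ _).trans_eq hc.eps_one)
      ((le_max_left _ _).trans_eq hc.eps_two)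
  obtain ⟨h1, h2, -⟩ := tensor_row (v := v) a.cast_nonneg ha
  have e1 : v.1.eps l 1 ≤ a := by
    have := (le_max_right _ _).trans_eq (h1.symm.trans hc.eps_one)
    linarith
  have e2 : v.1.eps l 2 ≤ 0 := (le_max_right _ _).trans_eq (h2.symm.trans hc.eps_two)
  obtain rfl | rfl : a = 0 ∨ a = 1 := by omega
  · obtain ⟨t, ht, hv⟩ := eq_row_of_eps_nonpos v.2 (by simpa using e1) e2
    have ht' : (t : ℚ) ≤ l := by exact_mod_cast ht
    have ht0 : (0 : ℚ) ≤ t := t.cast_nonneg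
    obtain ⟨r1, r2, r3⟩ := hc.eq (isHighest_tensor_row le_rfl (by simpa using ha)
      (by rw [hv]; exact strings_row l ht0) le_rfl (max_eq_left (by push_cast; linarith)) rfl)
    exact ⟨t, ht0, .inl ⟨by simpa using ha, hv, r1, by linarith, r3⟩⟩
  · obtain ⟨t, hv⟩ := eq_of_eps_le_one v.2 (by simpa using e1) e2
    have ht0 : (0 : ℚ) ≤ t := t.cast_nonneg
    have ha' : u.1 = ⟨1, 0, 0, 0, 0, 0⟩ := by simpa using ha
    refine ⟨t, ht0, .inr ⟨ha', ?_⟩⟩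
    -- `ε₀(v) ≥ 0` makes the first entry of the maximum defining `φ₀(u ⊗ v)` the larger one
    have main {e₀ q₀ e₁ q₁ q₂ : ℚ} (h : v.1.eps l 0 = e₀ ∧ v.1.phi l 0 = q₀ ∧
        v.1.eps l 1 = e₁ ∧ v.1.phi l 1 = q₁ ∧ v.1.eps l 2 = 0 ∧ v.1.phi l 2 = q₂)
        (he₀ : 0 ≤ e₀) : p₀ = q₀ ∧ p₁ = 1 + (q₁ - e₁) ∧ p₂ = q₂ := by
      have he₁ : e₁ ≤ 1 := by rw [← h.2.2.1]; simpa using e1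
      exact hc.eq (isHighest_tensor_row zero_le_one ha' h he₁
        (max_eq_left (by push_cast; linarith)) rfl)
    rcases hv with hv | hv | hv | hv | hv | hv
    · obtain ⟨r1, r2, r3⟩ := main (by rw [hv]; exact strings_row l ht0) (by linarith)
      exact .inl ⟨hv, r1, by linarith, r3⟩
    · rcases t.eq_zero_or_pos with rfl | ht
      · simp only [Nat.cast_zero] at hv
        obtain ⟨r1, r2, r3⟩ := main (by rw [hv]; exact strings_y₁ l) (by linarith)
        exact .inr <| .inr <| .inl ⟨hv, r1, by linarith, r3⟩
      · have ht1 : (1 : ℚ) ≤ t := by exact_mod_cast ht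
        have hs := v.2.sum_le
        simp only [hv, s] at hs
        -- `ε₀(v) = l + t - 3` is nonnegative only because `s(v) ≤ l` gives `2 ≤ t + 1 ≤ l`
        obtain ⟨r1, r2, r3⟩ := main (by rw [hv]; exact strings_y₁_of_one_le l ht1) (by linarith)
        exact .inr <| .inl ⟨hv, ht1, r1, by linarith, r3⟩
    · obtain ⟨r1, r2, r3⟩ := main (by rw [hv]; exact strings_x₂ l ht0) (by linarith)
      exact .inr <| .inr <| .inr <| .inl ⟨hv, r1, by linarith, r3⟩
    · obtain ⟨r1, r2, r3⟩ := main (by rw [hv]; exact strings_x₃_y₃ l ht0) (by linarith)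
      exact .inr <| .inr <| .inr <| .inr <| .inl ⟨hv, r1, by linarith, r3⟩
    · obtain ⟨r1, r2, r3⟩ := main (by rw [hv]; exact strings_x₂_x₃_y₃ l ht0) (by linarith)
      exact .inr <| .inr <| .inr <| .inr <| .inr <| .inl ⟨hv, r1, by linarith, r3⟩
    · obtain ⟨r1, r2, r3⟩ := main (by rw [hv]; exact strings_third l ht0) (by linarith)
      exact .inr <| .inr <| .inr <| .inr <| .inr <| .inr ⟨hv, r1, by linarith, r3⟩

/-! ### Crystal isomorphisms -/

theorem IsCrystalIso.exists_map_eq_some {X Y : Type} {C : CrystalData X} {D : CrystalData Y}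
    {Ψ : Option X → Option Y} (h : IsCrystalIso C D Ψ) (b : X) : ∃ c, Ψ (some b) = some c := by
  refine Option.ne_none_iff_exists'.1 fun h0 => ?_
  simpa using h.bijective.1 (h0.trans h.map_zero.symm)

theorem IsCrystalIso.isHighest {X Y : Type} {C : CrystalData X} {D : CrystalData Y}
    {Ψ : Option X → Option Y} (h : IsCrystalIso C D Ψ) {b : X} {c : Y} (hbc : Ψ (some b) = some c)
    {p₀ p₁ p₂ : ℚ} (hb : IsHighest C b p₀ p₁ p₂) : IsHighest D c p₀ p₁ p₂ :=
  ⟨(h.map_eps b c hbc 1).trans hb.eps_one, (h.map_eps b c hbc 2).trans hb.eps_two,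
    (h.map_phi b c hbc 0).trans hb.phi_zero, (h.map_phi b c hbc 1).trans hb.phi_one,
    (h.map_phi b c hbc 2).trans hb.phi_two⟩

theorem IsCrystalIso.map_f {X Y : Type} {C : CrystalData X} {D : CrystalData Y}
    {Ψ : Option X → Option Y} (hΨ : IsCrystalIso C D Ψ) (i : Fin 3) {b b' : X} {c c' : Y}
    (hbc : Ψ (some b) = some c) (hb : C.f i b = some b') (hc : D.f i c = some c') :
    Ψ (some b') = some c' := by
  obtain ⟨d, hd⟩ := hΨ.exists_map_eq_some b'
  have := (hΨ.map_arrow b b' c d hbc hd i hb).1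
  rw [hd, ← this, hc]

/-! ### The operator `f̃₀` on `(j,0,0,0,0,0) ⊗ (k,0,0,0,0,0)` -/

theorem toB_of_mem {l : ℕ} {c : Coord} (h : c.Mem l) : toB l c = some ⟨c, h⟩ := dif_pos h

theorem rawF_zero_row {t : ℚ} (ht : 0 ≤ t) :
    rawF 0 ⟨t, 0, 0, 0, 0, 0⟩ = some ⟨t + 1, 0, 0, 0, 0, 0⟩ := by
  have h : F₁ ⟨t, 0, 0, 0, 0, 0⟩ := by simp [F₁, z₁, z₂, z₃, z₄, ht]
  simp [rawF, rawF₀, h]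

theorem crystal_f_zero_row {l j : ℕ} {b : B l} (hb : b.1 = ⟨j, 0, 0, 0, 0, 0⟩) (hj : j + 1 ≤ l) :
    (crystal l).f 0 b = some ⟨⟨(j + 1 : ℕ), 0, 0, 0, 0, 0⟩, mem_row hj⟩ := by
  simp only [crystal, hb, rawF_zero_row j.cast_nonneg, Option.bind_some]
  rw [← Nat.cast_succ, toB_of_mem (mem_row hj)]

/-- Here `ε₀(v) = m + k` and `φ₀(u) = n - j`, so that `h` is the condition for `f̃₀` to act on the
left factor. -/
theorem tensor_f_zero_left {n m j k : ℕ} {u : B n} {v : B m} (hu : u.1 = ⟨j, 0, 0, 0, 0, 0⟩)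
    (hv : v.1 = ⟨k, 0, 0, 0, 0, 0⟩) (hj : j + 1 ≤ n) (h : m + k + j < n) :
    ((crystal n).tensor (crystal m)).f 0 (u, v) =
      some (⟨⟨(j + 1 : ℕ), 0, 0, 0, 0, 0⟩, mem_row hj⟩, v) := by
  have hlt : (crystal m).eps 0 v < (crystal n).phi 0 u := by
    have : (m : ℚ) + k + j < n := by exact_mod_cast h
    simp only [crystal, hu, hv, (strings_row m k.cast_nonneg).1, (strings_row n j.cast_nonneg).2.1]
    linarith
  simp only [CrystalData.tensor, if_pos hlt, crystal_f_zero_row hu hj]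
  rfl

theorem tensor_f_zero_right {n m j k : ℕ} {u : B n} {v : B m} (hu : u.1 = ⟨j, 0, 0, 0, 0, 0⟩)
    (hv : v.1 = ⟨k, 0, 0, 0, 0, 0⟩) (hk : k + 1 ≤ m) (h : n ≤ m + k + j) :
    ((crystal n).tensor (crystal m)).f 0 (u, v) =
      some (u, ⟨⟨(k + 1 : ℕ), 0, 0, 0, 0, 0⟩, mem_row hk⟩) := by
  have hlt : ¬ (crystal m).eps 0 v < (crystal n).phi 0 u := by
    have : (n : ℚ) ≤ m + k + j := by exact_mod_cast h
    simp only [crystal, hu, hv, (strings_row m k.cast_nonneg).1, (strings_row n j.cast_nonneg).2.1]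
    linarith
  simp only [CrystalData.tensor, if_neg hlt, crystal_f_zero_row hv hk]
  rfl

/-! ### Images under the isomorphism -/

theorem sends_of_eq {l m : ℕ} {R : Option (B l × B m) → Option (B m × B l)} {u v u' v' : Coord}
    (hu : u.Mem l) (hv : v.Mem m) {c : B m × B l} (h : R (some (⟨u, hu⟩, ⟨v, hv⟩)) = some c)
    (h₁ : c.1.1 = u') (h₂ : c.2.1 = v') : Sends R u v u' v' := by
  subst h₁ h₂
  exact ⟨hu, hv, c.1.2, c.2.2, h⟩

theorem Sends.congr {l m : ℕ} {R : Option (B l × B m) → Option (B m × B l)}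
    {u v u' v' a b a' b' : Coord} (h : Sends R u v u' v')
    (h₁ : u = a) (h₂ : v = b) (h₃ : u' = a') (h₄ : v' = b') : Sends R a b a' b' := by
  subst h₁ h₂ h₃ h₄
  exact h

/-- The image of a highest element `(j,0,0,0,0,0) ⊗ v`, with the values `φ₀, φ₁, φ₂` it inherits. -/
theorem exists_image {l : ℕ} {R : Option (B l × B 1) → Option (B 1 × B l)}
    (hR : IsCrystalIso ((crystal l).tensor (crystal 1)) ((crystal 1).tensor (crystal l)) R)
    {j : ℕ} (hj : j ≤ l) {v : Coord} (hv : v.Mem 1) {e₀ p₀ e₁ p₁ p₂ q₀ q₁ : ℚ}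
    (hs : v.eps 1 0 = e₀ ∧ v.phi 1 0 = p₀ ∧ v.eps 1 1 = e₁ ∧ v.phi 1 1 = p₁ ∧
      v.eps 1 2 = 0 ∧ v.phi 1 2 = p₂)
    (h : e₁ ≤ j) (hq₀ : max p₀ (l - j + (p₀ - e₀)) = q₀) (hq₁ : j + (p₁ - e₁) = q₁) :
    ∃ c, R (some (⟨_, mem_row hj⟩, ⟨v, hv⟩)) = some c ∧
      IsHighest ((crystal 1).tensor (crystal l)) c q₀ q₁ p₂ := by
  obtain ⟨c, hc⟩ := hR.exists_map_eq_some (⟨_, mem_row hj⟩, ⟨v, hv⟩)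
  exact ⟨c, hc, hR.isHighest hc
    (isHighest_tensor_row (v := ⟨v, hv⟩) j.cast_nonneg rfl hs h hq₀ hq₁)⟩

theorem mem_one : Mem 1 ⟨1, 0, 0, 0, 0, 0⟩ := by simpa using mem_row (le_refl 1)

theorem mem_zero (l : ℕ) : Mem l ⟨0, 0, 0, 0, 0, 0⟩ := by simpa using mem_row (Nat.zero_le l)

theorem sends_last_one {l : ℕ} {R : Option (B l × B 1) → Option (B 1 × B l)} (hl : 1 ≤ l)
    (hR : IsCrystalIso ((crystal l).tensor (crystal 1)) ((crystal 1).tensor (crystal l)) R) :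
    Sends R ⟨l, 0, 0, 0, 0, 0⟩ ⟨1, 0, 0, 0, 0, 0⟩ ⟨1, 0, 0, 0, 0, 0⟩ ⟨l, 0, 0, 0, 0, 0⟩ := by
  have hlQ : (1 : ℚ) ≤ l := by exact_mod_cast hl
  obtain ⟨c, hc, hh⟩ := exists_image hR le_rfl mem_one (strings_row 1 zero_le_one)
    l.cast_nonneg (max_eq_left (by push_cast; linarith)) rfl
  obtain ⟨t, ht, h⟩ := hh.cases hl
  push_cast at h
  rcases h with h | ⟨h0, h | h | h | h | h | h | h⟩
  · linarith
  · obtain rfl : t = l := by linarith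
    exact sends_of_eq _ _ hc h0 h.1
  all_goals linarith

theorem sends_row_one {l : ℕ} {R : Option (B l × B 1) → Option (B 1 × B l)} (hl : 1 ≤ l)
    (hR : IsCrystalIso ((crystal l).tensor (crystal 1)) ((crystal 1).tensor (crystal l)) R)
    {j : ℕ} (hj : j + 2 ≤ l) :
    Sends R ⟨j, 0, 0, 0, 0, 0⟩ ⟨1, 0, 0, 0, 0, 0⟩ ⟨1, 0, 0, 0, 0, 0⟩ ⟨j + 1, 0, 0, 0, 0, 1⟩ := by
  have hlQ : (1 : ℚ) ≤ l := by exact_mod_cast hl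
  have hjQ : (j : ℚ) + 2 ≤ l := by exact_mod_cast hj
  have hj0 : (0 : ℚ) ≤ j := j.cast_nonneg
  obtain ⟨c, hc, hh⟩ := exists_image hR (by omega) mem_one (strings_row 1 zero_le_one)
    j.cast_nonneg (max_eq_right (by push_cast; linarith)) rfl
  obtain ⟨t, ht, h⟩ := hh.cases hl
  push_cast at h
  rcases h with h | ⟨h0, h | h | h | h | h | h | h⟩
  · linarith
  · linarith
  · obtain rfl : t = j + 1 := by linarith
    exact sends_of_eq _ _ hc h0 h.1
  all_goals linarith

theorem sends_last_zero {l : ℕ} {R : Option (B l × B 1) → Option (B 1 × B l)} (hl : 1 ≤ l)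
    (hR : IsCrystalIso ((crystal l).tensor (crystal 1)) ((crystal 1).tensor (crystal l)) R) :
    Sends R ⟨l, 0, 0, 0, 0, 0⟩ ⟨0, 0, 0, 0, 0, 0⟩ ⟨1, 0, 0, 0, 0, 0⟩ ⟨l - 1, 0, 0, 0, 0, 0⟩ := by
  have hlQ : (1 : ℚ) ≤ l := by exact_mod_cast hl
  obtain ⟨c, hc, hh⟩ := exists_image hR le_rfl (mem_zero 1) (strings_row 1 le_rfl)
    l.cast_nonneg (max_eq_left (by push_cast; linarith)) rfl
  obtain ⟨t, ht, h⟩ := hh.cases hl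
  push_cast at h
  rcases h with h | ⟨h0, h | h | h | h | h | h | h⟩
  · linarith
  · obtain rfl : t = l - 1 := by linarith
    exact sends_of_eq _ _ hc h0 h.1
  all_goals linarith

theorem sends_last_x₂ {l : ℕ} {R : Option (B l × B 1) → Option (B 1 × B l)} (hl : 1 ≤ l)
    (hR : IsCrystalIso ((crystal l).tensor (crystal 1)) ((crystal 1).tensor (crystal l)) R) :
    Sends R ⟨l, 0, 0, 0, 0, 0⟩ ⟨0, 1, 0, 0, 0, 0⟩ ⟨1, 0, 0, 0, 0, 0⟩ ⟨l - 1, 1, 0, 0, 0, 0⟩ := by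
  have hlQ : (1 : ℚ) ≤ l := by exact_mod_cast hl
  obtain ⟨c, hc, hh⟩ := exists_image hR le_rfl mem_x₂ (strings_x₂ 1 le_rfl)
    hlQ (max_eq_left (by push_cast; linarith)) rfl
  obtain ⟨t, ht, h⟩ := hh.cases hl
  push_cast at h
  rcases h with h | ⟨h0, h | h | h | h | h | h | h⟩
  · linarith
  · linarith
  · linarith
  · linarith
  · obtain rfl : t = l - 1 := by linarith
    exact sends_of_eq _ _ hc h0 h.1
  all_goals linarith

theorem sends_row_x₂ {l : ℕ} {R : Option (B l × B 1) → Option (B 1 × B l)} (hl : 1 ≤ l)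
    (hR : IsCrystalIso ((crystal l).tensor (crystal 1)) ((crystal 1).tensor (crystal l)) R)
    {j : ℕ} (h1 : 1 ≤ j) (hj : j + 1 ≤ l) :
    Sends R ⟨j, 0, 0, 0, 0, 0⟩ ⟨0, 1, 0, 0, 0, 0⟩ ⟨1, 0, 0, 0, 0, 0⟩ ⟨j - 1, 1, 1, 1, 0, 0⟩ := by
  have hlQ : (1 : ℚ) ≤ l := by exact_mod_cast hl
  have hjQ : (1 : ℚ) ≤ j := by exact_mod_cast h1
  have hjl : (j : ℚ) + 1 ≤ l := by exact_mod_cast hj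
  obtain ⟨c, hc, hh⟩ := exists_image hR (by omega) mem_x₂ (strings_x₂ 1 le_rfl)
    hjQ (max_eq_right (by push_cast; linarith)) rfl
  obtain ⟨t, ht, h⟩ := hh.cases hl
  push_cast at h
  rcases h with h | ⟨h0, h | h | h | h | h | h | h⟩
  · linarith
  · linarith
  · linarith
  · linarith
  · linarith
  · linarith
  · obtain rfl : t = j - 1 := by linarith
    exact sends_of_eq _ _ hc h0 h.1
  · linarith

theorem sends_row_third {l : ℕ} {R : Option (B l × B 1) → Option (B 1 × B l)} (hl : 1 ≤ l)
    (hR : IsCrystalIso ((crystal l).tensor (crystal 1)) ((crystal 1).tensor (crystal l)) R)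
    {j : ℕ} (h1 : 1 ≤ j) (hj : j ≤ l) :
    Sends R ⟨j, 0, 0, 0, 0, 0⟩ ⟨0, 1 / 3, 1 / 3, 1, 0, 0⟩ ⟨1, 0, 0, 0, 0, 0⟩
      ⟨j - 1, 1 / 3, 1 / 3, 1, 0, 0⟩ := by
  have hlQ : (1 : ℚ) ≤ l := by exact_mod_cast hl
  have hjQ : (1 : ℚ) ≤ j := by exact_mod_cast h1
  have hjl : (j : ℚ) ≤ l := by exact_mod_cast hj
  obtain ⟨c, hc, hh⟩ := exists_image hR hj mem_third (strings_third 1 le_rfl)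
    hjQ (max_eq_right (by push_cast; linarith)) rfl
  obtain ⟨t, ht, h⟩ := hh.cases hl
  push_cast at h
  rcases h with h | ⟨h0, h | h | h | h | h | h | h⟩
  · linarith
  · linarith
  · linarith
  · linarith
  · linarith
  · linarith
  · linarith
  · obtain rfl : t = j - 1 := by linarith
    exact sends_of_eq _ _ hc h0 h.1

theorem sends_row_y₃ {l : ℕ} {R : Option (B l × B 1) → Option (B 1 × B l)} (hl : 1 ≤ l)
    (hR : IsCrystalIso ((crystal l).tensor (crystal 1)) ((crystal 1).tensor (crystal l)) R)
    {j : ℕ} (h1 : 2 ≤ j) (hj : j ≤ l) :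
    Sends R ⟨j, 0, 0, 0, 0, 0⟩ ⟨0, 0, 0, 2, 0, 0⟩ ⟨1, 0, 0, 0, 0, 0⟩ ⟨j - 2, 1, 0, 0, 0, 0⟩ := by
  have hlQ : (1 : ℚ) ≤ l := by exact_mod_cast hl
  have hjQ : (2 : ℚ) ≤ j := by exact_mod_cast h1
  have hjl : (j : ℚ) ≤ l := by exact_mod_cast hj
  obtain ⟨c, hc, hh⟩ := exists_image hR hj mem_y₃ (strings_y₃ 1)
    hjQ (max_eq_right (by push_cast; linarith)) rfl
  obtain ⟨t, ht, h⟩ := hh.cases hl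
  push_cast at h
  rcases h with h | ⟨h0, h | h | h | h | h | h | h⟩
  · linarith
  · linarith
  · linarith
  · linarith
  · obtain rfl : t = j - 2 := by linarith
    exact sends_of_eq _ _ hc h0 h.1
  all_goals linarith

theorem sends_one_y₁ {l : ℕ} {R : Option (B l × B 1) → Option (B 1 × B l)} (hl : 1 ≤ l)
    (hR : IsCrystalIso ((crystal l).tensor (crystal 1)) ((crystal 1).tensor (crystal l)) R) :
    Sends R ⟨1, 0, 0, 0, 0, 0⟩ ⟨0, 0, 0, 0, 0, 1⟩ ⟨1, 0, 0, 0, 0, 0⟩ ⟨0, 0, 0, 0, 0, 1⟩ := by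
  have hlQ : (1 : ℚ) ≤ l := by exact_mod_cast hl
  obtain ⟨c, hc, hh⟩ := exists_image hR hl mem_y₁ (strings_y₁ 1)
    (by simp) (max_eq_right (by push_cast; linarith)) rfl
  obtain ⟨t, ht, h⟩ := hh.cases hl
  push_cast at h
  rcases h with h | ⟨h0, h | h | h | h | h | h | h⟩
  · linarith
  · linarith
  · linarith
  · exact sends_of_eq _ _ hc h0 h.1
  all_goals linarith

theorem sends_row_y₁ {l : ℕ} {R : Option (B l × B 1) → Option (B 1 × B l)} (hl : 1 ≤ l)
    (hR : IsCrystalIso ((crystal l).tensor (crystal 1)) ((crystal 1).tensor (crystal l)) R)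
    {j : ℕ} (h1 : 2 ≤ j) (hj : j ≤ l) :
    Sends R ⟨j, 0, 0, 0, 0, 0⟩ ⟨0, 0, 0, 0, 0, 1⟩ ⟨1, 0, 0, 0, 0, 0⟩ ⟨j - 2, 0, 0, 0, 0, 0⟩ := by
  have hlQ : (1 : ℚ) ≤ l := by exact_mod_cast hl
  have hjQ : (2 : ℚ) ≤ j := by exact_mod_cast h1
  have hjl : (j : ℚ) ≤ l := by exact_mod_cast hj
  obtain ⟨c, hc, hh⟩ := exists_image hR hj mem_y₁ (strings_y₁ 1)
    (by linarith) (max_eq_right (by push_cast; linarith)) rfl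
  obtain ⟨t, ht, h⟩ := hh.cases hl
  push_cast at h
  rcases h with h | ⟨h0, h | h | h | h | h | h | h⟩
  · linarith
  · obtain rfl : t = j - 2 := by linarith
    exact sends_of_eq _ _ hc h0 h.1
  all_goals linarith

/-- Starting from `0 ⊗ 0 ↦ 0 ⊗ 0`, the operator `f̃₀` raises `j` on both sides. -/
theorem sends_row_zero {l : ℕ} {R : Option (B l × B 1) → Option (B 1 × B l)} (hl : 1 ≤ l)
    (hR : IsCrystalIso ((crystal l).tensor (crystal 1)) ((crystal 1).tensor (crystal l)) R)
    (j : ℕ) (hj : j + 1 ≤ l) :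
    Sends R ⟨j, 0, 0, 0, 0, 0⟩ ⟨0, 0, 0, 0, 0, 0⟩ ⟨0, 0, 0, 0, 0, 0⟩ ⟨j, 0, 0, 0, 0, 0⟩ := by
  have hlQ : (1 : ℚ) ≤ l := by exact_mod_cast hl
  induction j with
  | zero =>
    obtain ⟨c, hc, hh⟩ := exists_image hR (Nat.zero_le l) (mem_zero 1) (strings_row 1 le_rfl)
      (Nat.cast_nonneg 0) (max_eq_right (by push_cast; linarith)) rfl
    obtain ⟨t, ht, h⟩ := hh.cases hl
    push_cast at h
    rcases h with h | ⟨h0, h | h | h | h | h | h | h⟩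
    · obtain rfl : t = 0 := by linarith
      exact sends_of_eq _ _ hc h.1 (by simpa using h.2.1)
    all_goals linarith
  | succ k ih =>
    obtain ⟨hu, hv, hu', hv', h⟩ := ih (by omega)
    exact sends_of_eq _ _ (hR.map_f 0 h
      (tensor_f_zero_left (k := 0) rfl (by simp) (by omega) (by omega))
      (tensor_f_zero_right (j := 0) (by simp) rfl (by omega) (by omega))) rfl rfl

theorem sends_penultimate_one {l : ℕ} {R : Option (B l × B 1) → Option (B 1 × B l)} (hl : 1 ≤ l)
    (hR : IsCrystalIso ((crystal l).tensor (crystal 1)) ((crystal 1).tensor (crystal l)) R) :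
    Sends R ⟨l - 1, 0, 0, 0, 0, 0⟩ ⟨1, 0, 0, 0, 0, 0⟩ ⟨0, 0, 0, 0, 0, 0⟩ ⟨l, 0, 0, 0, 0, 0⟩ := by
  obtain ⟨k, rfl⟩ : ∃ k, l = k + 1 := ⟨l - 1, by omega⟩
  obtain ⟨hu, hv, hu', hv', h⟩ := sends_row_zero hl hR k le_rfl
  have h' := hR.map_f 0 h
    (tensor_f_zero_right (k := 0) rfl (by simp) (by omega) (by omega))
    (tensor_f_zero_right (j := 0) (by simp) rfl (by omega) (by omega))
  exact (sends_of_eq _ _ h' rfl rfl).congr (by simp) (by simp) rfl (by simp)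

theorem Sends.inj {l m : ℕ} {R : Option (B l × B m) → Option (B m × B l)}
    (hR : Function.Injective R) {u v w x u' v' : Coord} (h₁ : Sends R u v u' v')
    (h₂ : Sends R w x u' v') : u = w ∧ v = x := by
  obtain ⟨_, _, _, _, h₁⟩ := h₁
  obtain ⟨_, _, _, _, h₂⟩ := h₂
  have h := Option.some.inj (hR (h₁.trans h₂.symm))
  exact ⟨congrArg (fun p => p.1.1) h, congrArg (fun p => p.2.1) h⟩

theorem sends_row_x₃_y₃ {l : ℕ} {R : Option (B l × B 1) → Option (B 1 × B l)} (hl : 1 ≤ l)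
    (hR : IsCrystalIso ((crystal l).tensor (crystal 1)) ((crystal 1).tensor (crystal l)) R)
    {j : ℕ} (h1 : 1 ≤ j) (hj : j ≤ l) :
    Sends R ⟨j, 0, 0, 0, 0, 0⟩ ⟨0, 0, 1, 1, 0, 0⟩ ⟨1, 0, 0, 0, 0, 0⟩ ⟨j - 1, 0, 1, 1, 0, 0⟩ := by
  have hlQ : (1 : ℚ) ≤ l := by exact_mod_cast hl
  have hjQ : (1 : ℚ) ≤ j := by exact_mod_cast h1
  have hjl : (j : ℚ) ≤ l := by exact_mod_cast hj
  obtain ⟨c, hc, hh⟩ := exists_image hR hj mem_x₃_y₃ (strings_x₃_y₃ 1 le_rfl)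
    hjQ (max_eq_right (by push_cast; linarith)) rfl
  obtain ⟨t, ht, h⟩ := hh.cases hl
  push_cast at h
  rcases h with h | ⟨h0, h | h | h | h | h | h | h⟩
  · obtain rfl : t = j := by linarith
    -- the value `0 ⊗ (j,0,0,0,0,0)` is already taken
    have hS := sends_of_eq _ _ hc h.1 h.2.1
    rcases hj.lt_or_eq with hj | rfl
    · simpa using hS.inj hR.bijective.1 (sends_row_zero hl hR j hj)
    · simpa using hS.inj hR.bijective.1 (sends_penultimate_one hl hR)
  · linarith
  · linarith
  · linarith
  · linarith
  · obtain rfl : t = j - 1 := by linarith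
    exact sends_of_eq _ _ hc h0 h.1
  all_goals linarith

end G2Crystal

theorem proposition5 (l : ℕ) (hl : 1 ≤ l)
    (R : Option (G2Crystal.B l × G2Crystal.B 1) → Option (G2Crystal.B 1 × G2Crystal.B l))
    (hR : G2Crystal.IsCrystalIso
      ((G2Crystal.crystal l).tensor (G2Crystal.crystal 1))
      ((G2Crystal.crystal 1).tensor (G2Crystal.crystal l)) R) :
    -- b₂ = (1,0,0,0,0,0)
    G2Crystal.Sends R ⟨l, 0, 0, 0, 0, 0⟩ ⟨1, 0, 0, 0, 0, 0⟩
      ⟨1, 0, 0, 0, 0, 0⟩ ⟨l, 0, 0, 0, 0, 0⟩ ∧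
    G2Crystal.Sends R ⟨l - 1, 0, 0, 0, 0, 0⟩ ⟨1, 0, 0, 0, 0, 0⟩
      ⟨0, 0, 0, 0, 0, 0⟩ ⟨l, 0, 0, 0, 0, 0⟩ ∧
    (∀ j : ℕ, j + 2 ≤ l → G2Crystal.Sends R ⟨j, 0, 0, 0, 0, 0⟩ ⟨1, 0, 0, 0, 0, 0⟩
      ⟨1, 0, 0, 0, 0, 0⟩ ⟨j + 1, 0, 0, 0, 0, 1⟩) ∧
    -- b₂ = (0,0,0,0,0,0)
    G2Crystal.Sends R ⟨l, 0, 0, 0, 0, 0⟩ ⟨0, 0, 0, 0, 0, 0⟩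
      ⟨1, 0, 0, 0, 0, 0⟩ ⟨l - 1, 0, 0, 0, 0, 0⟩ ∧
    (∀ j : ℕ, j + 1 ≤ l → G2Crystal.Sends R ⟨j, 0, 0, 0, 0, 0⟩ ⟨0, 0, 0, 0, 0, 0⟩
      ⟨0, 0, 0, 0, 0, 0⟩ ⟨j, 0, 0, 0, 0, 0⟩) ∧
    -- b₂ = (0,1,0,0,0,0)
    G2Crystal.Sends R ⟨l, 0, 0, 0, 0, 0⟩ ⟨0, 1, 0, 0, 0, 0⟩
      ⟨1, 0, 0, 0, 0, 0⟩ ⟨l - 1, 1, 0, 0, 0, 0⟩ ∧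
    (∀ j : ℕ, 1 ≤ j → j + 1 ≤ l → G2Crystal.Sends R ⟨j, 0, 0, 0, 0, 0⟩ ⟨0, 1, 0, 0, 0, 0⟩
      ⟨1, 0, 0, 0, 0, 0⟩ ⟨j - 1, 1, 1, 1, 0, 0⟩) ∧
    -- b₂ = (0,1/3,1/3,1,0,0)
    (∀ j : ℕ, 1 ≤ j → j ≤ l → G2Crystal.Sends R ⟨j, 0, 0, 0, 0, 0⟩ ⟨0, 1 / 3, 1 / 3, 1, 0, 0⟩
      ⟨1, 0, 0, 0, 0, 0⟩ ⟨j - 1, 1 / 3, 1 / 3, 1, 0, 0⟩) ∧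
    -- b₂ = (0,0,1,1,0,0)
    (∀ j : ℕ, 1 ≤ j → j ≤ l → G2Crystal.Sends R ⟨j, 0, 0, 0, 0, 0⟩ ⟨0, 0, 1, 1, 0, 0⟩
      ⟨1, 0, 0, 0, 0, 0⟩ ⟨j - 1, 0, 1, 1, 0, 0⟩) ∧
    -- b₂ = (0,0,0,2,0,0)
    (∀ j : ℕ, 2 ≤ j → j ≤ l → G2Crystal.Sends R ⟨j, 0, 0, 0, 0, 0⟩ ⟨0, 0, 0, 2, 0, 0⟩
      ⟨1, 0, 0, 0, 0, 0⟩ ⟨j - 2, 1, 0, 0, 0, 0⟩) ∧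
    -- b₂ = (0,0,0,0,0,1)
    G2Crystal.Sends R ⟨1, 0, 0, 0, 0, 0⟩ ⟨0, 0, 0, 0, 0, 1⟩
      ⟨1, 0, 0, 0, 0, 0⟩ ⟨0, 0, 0, 0, 0, 1⟩ ∧
    (∀ j : ℕ, 2 ≤ j → j ≤ l → G2Crystal.Sends R ⟨j, 0, 0, 0, 0, 0⟩ ⟨0, 0, 0, 0, 0, 1⟩
      ⟨1, 0, 0, 0, 0, 0⟩ ⟨j - 2, 0, 0, 0, 0, 0⟩) := by
  exact ⟨G2Crystal.sends_last_one hl hR, G2Crystal.sends_penultimate_one hl hR,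
    fun _ => G2Crystal.sends_row_one hl hR, G2Crystal.sends_last_zero hl hR,
    G2Crystal.sends_row_zero hl hR, G2Crystal.sends_last_x₂ hl hR,
    fun _ => G2Crystal.sends_row_x₂ hl hR, fun _ => G2Crystal.sends_row_third hl hR,
    fun _ => G2Crystal.sends_row_x₃_y₃ hl hR, fun _ => G2Crystal.sends_row_y₃ hl hR,
    G2Crystal.sends_one_y₁ hl hR, fun _ => G2Crystal.sends_row_y₁ hl hR⟩
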